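/- Lemma (Compactness). Let $d\ge 1$ and let ${\cal L}\subset\mathbb R^d$ be a discrete periodic set, that is, a non-empty set with finitely many points in every ball and such that ${\cal L}+b_k={\cal L}$ for $k=1,\dots,d$, for some basis $b_1,\dots,b_d$ of $\mathbb R^d$ (for instance the canonical one). Let $Q_R=[-R/2,R/2)^d$. For $\varepsilon,\eta>0$ and a spin function $u:\varepsilon{\cal L}\to\{0,1\}$ write $u_i=u(\varepsilon i)$ for $i\in{\cal L}$, and $$E_{\varepsilon,\eta}(u)=\frac{\varepsilon^{2d}}{\eta^{d+1}}\sum_{i,j\in{\cal L},\ i-j\in Q_{\eta/\varepsilon}}|u_i-u_j|\in[0,+\infty].$$ Identify $u$ with its piecewise-constant interpolation, defined for almost every $x\in\mathbb R^d$ by $u(x)=u_i$ if $x\in\varepsilon V_i$, where $V_i=\{x\in\mathbb R^d: |x-i|<|x-j|\hbox{ for all }j\in{\cal L},\ j\ne i\}$ is the Voronoi cell of $i\in{\cal L}$. Let $\varepsilon_n>0$ and $\eta_n>0$ be sequences with $\varepsilon_n\to0$, $\eta_n\to0$ and $\varepsilon_n/\eta_n\to0$, and let $u^n:\varepsilon_n{\cal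 L}\to\{0,1\}$ be spin functions such that $\sup_n E_{\varepsilon_n,\eta_n}(u^n)<+\infty$. Then there exist a subsequence $(u^{n_k})$ and a measurable set $A\subset\mathbb R^d$ of finite perimeter, i.e. $$\sup\Bigl\{\int_A {\rm div}\,\varphi\,dx:\ \varphi\in C^1_c(\mathbb R^d;\mathbb R^d),\ |\varphi|\le1\Bigr\}<+\infty,$$ such that the interpolations of $u^{n_k}$ converge to $\chi_A$ in $L^1_{\rm loc}(\mathbb R^d)$ as $k\to\infty$. -/

import Mathlib

open scoped ENNReal NNReal Topology Pointwise
open Set Filter MeasureTheory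

noncomputable section

/-- A discrete periodic subset of `ℝ^d`: nonempty, with finitely many points in every ball, and
invariant under the translations by the vectors of some basis of `ℝ^d`. -/
structure IsDiscretePeriodic {d : ℕ} (L : Set (EuclideanSpace ℝ (Fin d))) : Prop where
  nonempty : L.Nonempty
  finite_inter_ball : ∀ R : ℝ, (L ∩ Metric.closedBall 0 R).Finite
  periodic : ∃ b : Module.Basis (Fin d) ℝ (EuclideanSpace ℝ (Fin d)),
    ∀ k : Fin d, (fun x => x + b k) '' L = L

/-- The semi-open coordinate cube `[-R/2, R/2)^d`. -/
def cube {d : ℕ} (R : ℝ) : Set (EuclideanSpace ℝ (Fin d)) :=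
  {x | ∀ k : Fin d, -(R / 2) ≤ x k ∧ x k < R / 2}

/-- The (open) Voronoi cell of the point `i` of `L`. -/
def voronoiCell {d : ℕ} (L : Set (EuclideanSpace ℝ (Fin d))) (i : EuclideanSpace ℝ (Fin d)) :
    Set (EuclideanSpace ℝ (Fin d)) :=
  {x | ∀ j ∈ L, j ≠ i → dist x i < dist x j}

/-- Spin functions `u : εL → {0, 1}`. -/
abbrev SpinFunction {d : ℕ} (L : Set (EuclideanSpace ℝ (Fin d))) (ε : ℝ) : Type :=
  ↥(ε • L) → ({0, 1} : Set ℝ)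

/-- The value `u_i = u (ε i)`, for `i ∈ L`. -/
def SpinFunction.site {d : ℕ} {L : Set (EuclideanSpace ℝ (Fin d))} {ε : ℝ}
    (u : SpinFunction L ε) (i : L) : ℝ :=
  (u ⟨ε • (i : EuclideanSpace ℝ (Fin d)), Set.smul_mem_smul_set i.2⟩ : ℝ)

/-- The energy `ε^{2d} / η^{d+1} ∑ |u_i - u_j|`, the sum being over all ordered pairs
`(i, j) ∈ L × L` such that `i - j` lies in the cube of side `η / ε`; a value in `[0, ∞]`. -/
def energy {d : ℕ} {L : Set (EuclideanSpace ℝ (Fin d))} (ε η : ℝ) (u : SpinFunction L ε) :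
    ℝ≥0∞ :=
  ENNReal.ofReal (ε ^ (2 * d) / η ^ (d + 1)) *
    ∑' p : {p : L × L //
        (p.1 : EuclideanSpace ℝ (Fin d)) - (p.2 : EuclideanSpace ℝ (Fin d)) ∈ cube (η / ε)},
      ENNReal.ofReal |u.site p.1.1 - u.site p.1.2|

open Classical in
/-- The piecewise-constant interpolation of `u`: it equals `u_i` on the scaled Voronoi cell
`ε V_i`, for every `i ∈ L`. The value `0` outside of the union of these open cells is immaterial,
this being a Lebesgue-null set. -/
def SpinFunction.interpolation {d : ℕ} {L : Set (EuclideanSpace ℝ (Fin d))} {ε : ℝ}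
    (u : SpinFunction L ε) (x : EuclideanSpace ℝ (Fin d)) : ℝ :=
  if h : ∃ i : L, x ∈ ε • voronoiCell L i then u.site h.choose else 0

theorem SpinFunction.interpolation_eq {d : ℕ} {L : Set (EuclideanSpace ℝ (Fin d))} {ε : ℝ}
    (hε : 0 < ε) (u : SpinFunction L ε) (i : L) {x : EuclideanSpace ℝ (Fin d)}
    (hx : x ∈ ε • voronoiCell L i) : u.interpolation x = u.site i := by
  have h : ∃ i : L, x ∈ ε • voronoiCell L i := ⟨i, hx⟩
  have key : h.choose = i := by
    by_contra hne
    have h1 := (Set.mem_smul_set_iff_inv_smul_mem₀ hε.ne' _ _).1 h.choose_spec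
    have h2 := (Set.mem_smul_set_iff_inv_smul_mem₀ hε.ne' _ _).1 hx
    have a := h1 i i.2 (fun e => hne (Subtype.ext e.symm))
    have b := h2 h.choose h.choose.2 (fun e => hne (Subtype.ext e))
    exact lt_asymm a b
  rw [SpinFunction.interpolation, dif_pos h, key]

/-- Convergence in `L^1_loc(ℝ^d)`: all the functions are locally integrable, and there is
convergence in `L^1(K)` for every compact set `K`. -/
def TendstoL1Loc {d : ℕ} (f : ℕ → EuclideanSpace ℝ (Fin d) → ℝ)
    (g : EuclideanSpace ℝ (Fin d) → ℝ) : Prop :=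
  (∀ n, LocallyIntegrable (f n) volume) ∧ LocallyIntegrable g volume ∧
    ∀ K : Set (EuclideanSpace ℝ (Fin d)), IsCompact K →
      Tendsto (fun n => eLpNorm (f n - g) 1 (volume.restrict K)) atTop (𝓝 0)

/-- The divergence `∑_k ∂φ_k/∂x_k` of a vector field. -/
def divergence {d : ℕ} (φ : EuclideanSpace ℝ (Fin d) → EuclideanSpace ℝ (Fin d))
    (x : EuclideanSpace ℝ (Fin d)) : ℝ :=
  ∑ k : Fin d, (fderiv ℝ φ x (EuclideanSpace.single k 1)) k

/-- The perimeter in `ℝ^d` of a (measurable) set `A`: the supremum of `∫_A div φ` over the `C^1`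
vector fields `φ` with compact support and `|φ| ≤ 1` everywhere. -/
def perimeter {d : ℕ} (A : Set (EuclideanSpace ℝ (Fin d))) : ℝ≥0∞ :=
  ⨆ (φ : EuclideanSpace ℝ (Fin d) → EuclideanSpace ℝ (Fin d)) (_ : ContDiff ℝ 1 φ)
    (_ : HasCompactSupport φ) (_ : ∀ x, ‖φ x‖ ≤ 1), ENNReal.ofReal (∫ x in A, divergence φ x)

/-- `A` is a set of finite perimeter in `ℝ^d`. -/
def HasFinitePerimeter {d : ℕ} (A : Set (EuclideanSpace ℝ (Fin d))) : Prop :=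
  MeasurableSet A ∧ perimeter A < ∞

end

/-! Everything is controlled by the translation defect, the `L¹` distance between a function and its
translate by `h`. Since `εD` is small compared with `η` (with `D` a covering radius of the lattice),
two points at distance less than `η / 4` lie in Voronoi cells whose centres interact in the energy.
Hence the energy bounds the integral of `|u(y) - u(x)|` over all such pairs, which is the integral
of the defect over a ball of radius `η / 4`.

Subadditivity of the defect in `h` turns this integral bound into a bound by a multiple of `η` for
every `‖h‖ < η / 8` (`measure_ball_mul_translationDefect_le`). Chaining short translations then
gives a bound by `C (‖h‖ + η)` for all `h` (`SpinFunction.translationDefect_interpolation_le`).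

Such a bound gives compactness in the manner of Riesz–Kolmogorov: along a weak-* convergent
subsequence, averages over small balls converge pointwise, and the functions are `L¹`-close to their
averages (`exists_subseq_ae_tendsto_of_translationDefect_le`). The limit is again an indicator. By
Fatou its defect is at most `C ‖h‖`, and difference quotients of test fields convert this into
finite perimeter (`perimeter_le_of_translationDefect_le`). -/

/-! ### Translation defects and their subadditivity. -/

section Translation

variable {E : Type*} [NormedAddCommGroup E] [MeasurableSpace E]

/-- The `L¹` distance between a function and its translate by `h`. -/
noncomputable def translationDefect (μ : Measure E) (v : E → ℝ) (h : E) : ℝ≥0∞ :=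
  ∫⁻ x, ‖v (x + h) - v x‖ₑ ∂μ

theorem translationDefect_zero (μ : Measure E) (v : E → ℝ) : translationDefect μ v 0 = 0 := by
  simp [translationDefect]

variable [BorelSpace E]

theorem translationDefect_add_le {μ : Measure E} [μ.IsAddRightInvariant] {v : E → ℝ}
    (hv : Measurable v) (h k : E) :
    translationDefect μ v (h + k) ≤ translationDefect μ v h + translationDefect μ v k := by
  have e : translationDefect μ v h = ∫⁻ x, ‖v (x + k + h) - v (x + k)‖ₑ ∂μ :=
    (lintegral_add_right_eq_self (fun x => ‖v (x + h) - v x‖ₑ) k).symm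
  rw [e, translationDefect, translationDefect, ← lintegral_add_left (by fun_prop)]
  refine lintegral_mono fun x => ?_
  have : v (x + (h + k)) - v x = (v (x + k + h) - v (x + k)) + (v (x + k) - v x) := by
    rw [add_comm h k, add_assoc]; ring
  rw [this]
  exact enorm_add_le _ _

theorem translationDefect_nsmul_le {μ : Measure E} [μ.IsAddRightInvariant] {v : E → ℝ}
    (hv : Measurable v) (h : E) (n : ℕ) :
    translationDefect μ v (n • h) ≤ n * translationDefect μ v h := by
  induction n with
  | zero => simp [translationDefect_zero]
  | succ n ih =>
    rw [succ_nsmul]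
    refine (translationDefect_add_le hv _ _).trans ?_
    push_cast
    rw [add_mul, one_mul]
    gcongr

/-- A long translation is a chain of equal translations shorter than `r`, and defects add up along
the chain. -/
theorem translationDefect_le_of_forall_norm_lt [NormedSpace ℝ E] {μ : Measure E}
    [μ.IsAddRightInvariant] {v : E → ℝ} (hv : Measurable v) {r : ℝ} (hr : 0 < r) {M : ℝ≥0∞}
    (hM : ∀ h, ‖h‖ < r → translationDefect μ v h ≤ M) (h : E) :
    translationDefect μ v h ≤ ENNReal.ofReal (‖h‖ / r + 1) * M := by
  -- The `+ 1` makes each step strictly shorter than `r`, and keeps `N` positive when `h = 0`.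
  set N : ℕ := ⌊‖h‖ / r⌋₊ + 1 with hN
  have hNpos : (0 : ℝ) < N := by positivity
  have h1 : ‖h‖ / r < N := by simpa [hN] using Nat.lt_floor_add_one (‖h‖ / r)
  have h2 : (N : ℝ) ≤ ‖h‖ / r + 1 := by
    simpa [hN] using Nat.floor_le (div_nonneg (norm_nonneg h) hr.le)
  have h3 : ‖(N : ℝ)⁻¹ • h‖ < r := by
    rw [norm_smul, norm_inv, Real.norm_natCast, inv_mul_lt_iff₀ hNpos]
    rwa [div_lt_iff₀ hr] at h1
  have h4 : N • ((N : ℝ)⁻¹ • h) = h := by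
    rw [← Nat.cast_smul_eq_nsmul ℝ, smul_inv_smul₀ hNpos.ne']
  calc translationDefect μ v h = translationDefect μ v (N • ((N : ℝ)⁻¹ • h)) := by rw [h4]
    _ ≤ N * translationDefect μ v ((N : ℝ)⁻¹ • h) := translationDefect_nsmul_le hv _ _
    _ ≤ ENNReal.ofReal (‖h‖ / r + 1) * M := by
        gcongr
        · rw [← ENNReal.ofReal_natCast]
          exact ENNReal.ofReal_le_ofReal h2
        · exact hM _ h3

variable [SecondCountableTopology E]

theorem measurable_translationDefect {μ : Measure E} [SFinite μ] {v : E → ℝ} (hv : Measurable v) :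
    Measurable (translationDefect μ v) := by
  unfold translationDefect
  have : Measurable (Function.uncurry fun (h x : E) => ‖v (x + h) - v x‖ₑ) := by
    unfold Function.uncurry
    fun_prop
  exact this.lintegral_prod_right'

theorem setLIntegral_ball_translationDefect {μ : Measure E} [SFinite μ] [μ.IsAddLeftInvariant]
    {v : E → ℝ} (hv : Measurable v) (r : ℝ) :
    ∫⁻ h in Metric.ball 0 r, translationDefect μ v h ∂μ =
      ∫⁻ x, ∫⁻ y, (Metric.ball x r).indicator (fun y => ‖v y - v x‖ₑ) y ∂μ ∂μ := by
  unfold translationDefect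
  rw [lintegral_lintegral_swap]
  · refine lintegral_congr fun x => ?_
    rw [← lintegral_indicator Metric.isOpen_ball.measurableSet,
      ← lintegral_add_left_eq_self ((Metric.ball x r).indicator fun y => ‖v y - v x‖ₑ) x]
    refine lintegral_congr fun h => ?_
    simp only [indicator, Metric.mem_ball, dist_zero_right, dist_self_add_left]
  · have : Measurable (Function.uncurry fun (h x : E) => ‖v (x + h) - v x‖ₑ) := by
      unfold Function.uncurry
      fun_prop
    exact this.aemeasurable

/-- Passes from an average to each single `h`: write `h = k + (h - k)`, use subadditivity and
integrate over `k` in the ball of radius `r`. Both `k` and `h - k` stay in the ball of radius `2 *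
r`. -/
theorem measure_ball_mul_translationDefect_le {μ : Measure E} [SFinite μ] [μ.IsAddLeftInvariant]
    [μ.IsAddRightInvariant] [μ.IsNegInvariant]
    {v : E → ℝ} (hv : Measurable v) {r : ℝ} {h : E} (hh : ‖h‖ < r) :
    μ (Metric.ball 0 r) * translationDefect μ v h ≤
      2 * ∫⁻ k in Metric.ball 0 (2 * r), translationDefect μ v k ∂μ := by
  have hr : r ≤ 2 * r := by linarith [norm_nonneg h]
  have hm := measurable_translationDefect (μ := μ) hv
  calc μ (Metric.ball 0 r) * translationDefect μ v h
      = ∫⁻ _ in Metric.ball (0 : E) r, translationDefect μ v h ∂μ := by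
        rw [setLIntegral_const, mul_comm]
    _ ≤ ∫⁻ k in Metric.ball (0 : E) r,
          (translationDefect μ v k + translationDefect μ v (h - k)) ∂μ := by
        refine lintegral_mono fun k => ?_
        simpa using translationDefect_add_le (μ := μ) hv k (h - k)
    _ = ∫⁻ k in Metric.ball (0 : E) r, translationDefect μ v k ∂μ +
          ∫⁻ k in Metric.ball (0 : E) r, translationDefect μ v (h - k) ∂μ :=
        lintegral_add_left hm _
    _ ≤ ∫⁻ k in Metric.ball 0 (2 * r), translationDefect μ v k ∂μ +
          ∫⁻ k in Metric.ball 0 (2 * r), translationDefect μ v k ∂μ := by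
        refine add_le_add (lintegral_mono_set (Metric.ball_subset_ball hr)) ?_
        rw [← lintegral_indicator Metric.isOpen_ball.measurableSet,
          ← lintegral_indicator Metric.isOpen_ball.measurableSet,
          ← lintegral_sub_left_eq_self (μ := μ) ((Metric.ball (0 : E) (2 * r)).indicator _) h]
        refine lintegral_mono fun k => indicator_le
          (g := fun k => (Metric.ball (0 : E) (2 * r)).indicator _ (h - k)) (fun k hk => ?_) k
        rw [indicator_of_mem]
        rw [mem_ball_zero_iff] at hk ⊢
        linarith [norm_sub_le h k]
    _ = _ := (two_mul _).symm

end Translation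

/-! ### Compactness from uniform translation estimates. -/

section Compactness

/-- A finite `ν` puts bounded functions in `L¹`. The bound `ν ≤ μ` transfers the defect estimates to
`ν`, and `μ ≪ ν` brings almost everywhere convergence back to `μ`. -/
theorem exists_isFiniteMeasure_le_absolutelyContinuous {α : Type*} [MeasurableSpace α]
    (μ : Measure α) [SigmaFinite μ] :
    ∃ ν : Measure α, IsFiniteMeasure ν ∧ ν ≤ μ ∧ μ ≪ ν := by
  obtain ⟨g, hgpos, hgm, hg⟩ := exists_pos_lintegral_lt_of_sigmaFinite μ one_ne_zero
  refine ⟨μ.withDensity fun x => min (g x) 1, ?_, ?_, ?_⟩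
  · refine isFiniteMeasure_withDensity (ne_of_lt ((lintegral_mono fun x => ?_).trans_lt
      (hg.trans ENNReal.one_lt_top)))
    exact min_le_left _ _
  · calc μ.withDensity (fun x => min (g x : ℝ≥0∞) 1) ≤ μ.withDensity 1 :=
          withDensity_mono (Eventually.of_forall fun x => min_le_right _ _)
      _ = μ := withDensity_one
  · refine withDensity_absolutelyContinuous' (by fun_prop) (Eventually.of_forall fun x => ?_)
    have := hgpos x
    simp [this.ne']

/-- Sequential Banach–Alaoglu in the dual of the separable space `L¹`, on which bounded functions
act by integration. -/
theorem exists_subseq_forall_tendsto_integral_mul {α : Type*} [MeasurableSpace α] {μ : Measure α}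
    [SigmaFinite μ] [IsSeparable μ] {v : ℕ → α → ℝ} (hv : ∀ n, Measurable (v n))
    (hv1 : ∀ n x, ‖v n x‖ ≤ 1) :
    ∃ s : ℕ → ℕ, StrictMono s ∧ ∀ g : α → ℝ, Integrable g μ →
      ∃ l, Tendsto (fun n => ∫ x, v (s n) x * g x ∂μ) atTop (𝓝 l) := by
  have hmem : ∀ n, MemLp (v n) ∞ μ := fun n =>
    memLp_top_of_bound (hv n).aestronglyMeasurable 1 (Eventually.of_forall (hv1 n))
  let Φ : Lp ℝ ∞ μ →L[ℝ] StrongDual ℝ (Lp ℝ 1 μ) :=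
    (ContinuousLinearMap.mul ℝ ℝ).lpPairing μ ∞ 1
  have hnorm : ∀ n, ‖(hmem n).toLp‖ ≤ 1 := fun n => by
    rw [Lp.norm_toLp, eLpNorm_exponent_top]
    refine ENNReal.toReal_le_of_le_ofReal zero_le_one ?_
    exact eLpNormEssSup_le_of_ae_bound (Eventually.of_forall (hv1 n))
  have : Fact ((1 : ℝ≥0∞) ≠ ∞) := ⟨ENNReal.one_ne_top⟩
  obtain ⟨φ, -, s, hs, hφ⟩ := WeakDual.isSeqCompact_closedBall ℝ (Lp ℝ 1 μ) 0 ‖Φ‖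
    (x := fun n => StrongDual.toWeakDual (Φ (hmem n).toLp)) (fun n => by
      rw [mem_preimage, mem_closedBall_zero_iff]
      refine (Φ.le_opNorm _).trans ?_
      exact mul_le_of_le_one_right (norm_nonneg _) (hnorm n))
  refine ⟨s, hs, fun g hg => ?_⟩
  have hg' : MemLp g 1 μ := memLp_one_iff_integrable.2 hg
  refine ⟨φ hg'.toLp, ?_⟩
  have := (WeakDual.eval_continuous hg'.toLp).tendsto φ |>.comp hφ
  refine this.congr fun n => ?_
  have e : Φ (hmem (s n)).toLp hg'.toLp = _ :=
    ContinuousLinearMap.lpPairing_eq_integral (ContinuousLinearMap.mul ℝ ℝ) _ _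
  refine e.trans (integral_congr_ae ?_)
  filter_upwards [(hmem (s n)).coeFn_toLp, hg'.coeFn_toLp] with x hx hgx
  simp [hx, hgx]

variable {E : Type*} [NormedAddCommGroup E] [MeasurableSpace E] [BorelSpace E]

theorem integral_cond_ball_translate [NormedSpace ℝ E] [FiniteDimensional ℝ E] (μ : Measure E)
    [μ.IsAddHaarMeasure] (v : E → ℝ) (r : ℝ) (x : E) :
    ∫ h, v (x + h) ∂(ProbabilityTheory.cond μ (Metric.ball 0 r)) =
      ∫ y, v y * (Metric.ball x r).indicator (fun _ => (μ (Metric.ball 0 r))⁻¹.toReal) y ∂μ := by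
  rw [ProbabilityTheory.cond, integral_smul_measure,
    ← integral_indicator Metric.isOpen_ball.measurableSet,
    ← integral_add_left_eq_self (fun y => v y * _) x, smul_eq_mul, ← integral_const_mul]
  refine integral_congr_ae (Eventually.of_forall fun h => ?_)
  simp only [indicator, Metric.mem_ball, dist_zero_right, dist_self_add_left]
  split_ifs <;> ring

variable [SecondCountableTopology E]

theorem lintegral_enorm_integral_translate_sub_le {μ π : Measure E} [SFinite μ]
    [IsProbabilityMeasure π] {v : E → ℝ} (hv : Measurable v) (hv1 : ∀ x, ‖v x‖ ≤ 1) :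
    ∫⁻ x, ‖(∫ h, v (x + h) ∂π) - v x‖ₑ ∂μ ≤ ∫⁻ h, translationDefect μ v h ∂π := by
  have hm : Measurable (Function.uncurry fun (h x : E) => ‖v (x + h) - v x‖ₑ) := by
    unfold Function.uncurry
    fun_prop
  unfold translationDefect
  rw [lintegral_lintegral_swap hm.aemeasurable]
  refine lintegral_mono fun x => ?_
  have hint : Integrable (fun h => v (x + h)) π :=
    Integrable.of_bound (hv.comp (measurable_const_add x)).aestronglyMeasurable 1
      (Eventually.of_forall fun h => hv1 _)
  have e : (∫ h, v (x + h) ∂π) - v x = ∫ h, (v (x + h) - v x) ∂π := by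
    rw [integral_sub hint (integrable_const _)]
    simp
  rw [e]
  exact enorm_integral_le_lintegral_enorm _

/-- The function `g` may depend on `δ`, so no limit has to be known beforehand. -/
theorem cauchySeq_toLp_of_forall_eventually_lintegral_sub_le {α : Type*} [MeasurableSpace α]
    {ν : Measure α} {v : ℕ → α → ℝ} (hv : ∀ n, MemLp (v n) 1 ν)
    (h : ∀ δ : ℝ≥0∞, δ ≠ 0 → ∃ g, AEStronglyMeasurable g ν ∧
      ∀ᶠ n in atTop, ∫⁻ x, ‖v n x - g x‖ₑ ∂ν ≤ δ) :
    CauchySeq fun n => (hv n).toLp := by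
  rw [EMetric.cauchySeq_iff]
  intro δ hδ
  obtain ⟨δ', hδ', hlt⟩ := exists_between (ENNReal.half_pos hδ.ne')
  obtain ⟨g, hg, hev⟩ := h δ' hδ'.ne'
  obtain ⟨N, hN⟩ := eventually_atTop.1 hev
  refine ⟨N, fun m hm n hn => ?_⟩
  rw [Lp.edist_toLp_toLp, eLpNorm_one_eq_lintegral_enorm]
  calc ∫⁻ x, ‖(v m - v n) x‖ₑ ∂ν
      ≤ ∫⁻ x, (‖v m x - g x‖ₑ + ‖v n x - g x‖ₑ) ∂ν := by
        refine lintegral_mono fun x => ?_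
        have : (v m - v n) x = (v m x - g x) - (v n x - g x) := by simp
        rw [this]
        exact enorm_sub_le
    _ = ∫⁻ x, ‖v m x - g x‖ₑ ∂ν + ∫⁻ x, ‖v n x - g x‖ₑ ∂ν :=
        lintegral_add_left' ((hv m).1.sub hg).enorm _
    _ ≤ δ' + δ' := add_le_add (hN m hm) (hN n hn)
    _ < δ := by
        rw [← ENNReal.add_halves δ]
        exact ENNReal.add_lt_add hlt hlt

variable [NormedSpace ℝ E] [FiniteDimensional ℝ E]

/-- Here `g` is the pointwise limit of the averages of `v n` over balls of radius `r`. These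
averages are integrals against a fixed `L¹` function, so they converge by `hconv`, and then in
`L¹(ν)` by dominated convergence. Averaging itself costs at most the mean defect over the ball. -/
theorem eventually_lintegral_sub_le_of_translationDefect_le {μ ν : Measure E}
    [μ.IsAddHaarMeasure] [IsFiniteMeasure ν] (hνμ : ν ≤ μ) {v : ℕ → E → ℝ}
    (hv : ∀ n, Measurable (v n)) (hv1 : ∀ n x, ‖v n x‖ ≤ 1) {η : ℕ → ℝ}
    (hη : Tendsto η atTop (𝓝 0)) {C : ℝ≥0}
    (hC : ∀ n h, translationDefect μ (v n) h ≤ C * ENNReal.ofReal (‖h‖ + η n))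
    (hconv : ∀ g : E → ℝ, Integrable g μ →
      ∃ l, Tendsto (fun n => ∫ x, v n x * g x ∂μ) atTop (𝓝 l)) {δ : ℝ≥0∞} (hδ : δ ≠ 0) :
    ∃ g, AEStronglyMeasurable g ν ∧ ∀ᶠ n in atTop, ∫⁻ x, ‖v n x - g x‖ₑ ∂ν ≤ δ := by
  -- One `r` bounds `‖h‖` in the ball; the other will bound `η n` for large `n`.
  obtain ⟨r, hr, hrδ⟩ : ∃ r : ℝ, 0 < r ∧ C * ENNReal.ofReal (r + r) < δ / 2 := by
    have : Tendsto (fun r : ℝ => C * ENNReal.ofReal (r + r)) (𝓝[>] 0) (𝓝 0) := by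
      have h0 : Continuous fun r : ℝ => C * ENNReal.ofReal (r + r) :=
        ENNReal.continuous_const_mul ENNReal.coe_ne_top |>.comp
          (ENNReal.continuous_ofReal.comp (by fun_prop))
      simpa using (h0.tendsto 0).mono_left nhdsWithin_le_nhds
    obtain ⟨r, h1, h2⟩ := ((this.eventually_lt_const (ENNReal.half_pos hδ)).and
      self_mem_nhdsWithin).exists
    exact ⟨r, h2, h1⟩
  have hball0 : μ (Metric.ball (0 : E) r) ≠ 0 := (Metric.measure_ball_pos μ _ hr).ne'
  have hballt : μ (Metric.ball (0 : E) r) ≠ ∞ := measure_ball_lt_top.ne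
  set π := ProbabilityTheory.cond μ (Metric.ball (0 : E) r) with hπ
  have hprob : IsProbabilityMeasure π := ProbabilityTheory.cond_isProbabilityMeasure_of_finite
    hball0 hballt
  let w : ℕ → E → ℝ := fun n x => ∫ h, v n (x + h) ∂π
  have hwm : ∀ n, StronglyMeasurable (w n) := fun n => by
    have : StronglyMeasurable (Function.uncurry fun x h => v n (x + h)) := by
      apply Measurable.stronglyMeasurable
      unfold Function.uncurry
      fun_prop
    exact this.integral_prod_right
  have hw1 : ∀ n x, ‖w n x‖ ≤ 1 := fun n x => by
    refine (norm_integral_le_of_norm_le_const (C := 1)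
      (Eventually.of_forall fun h => hv1 n _)).trans ?_
    simp
  have hlim : ∀ x, ∃ l, Tendsto (fun n => w n x) atTop (𝓝 l) := fun x => by
    have hint : Integrable ((Metric.ball x r).indicator
        (fun _ => (μ (Metric.ball 0 r))⁻¹.toReal)) μ :=
      (integrable_indicator_iff Metric.isOpen_ball.measurableSet).2
        (integrableOn_const measure_ball_lt_top.ne)
    obtain ⟨l, hl⟩ := hconv _ hint
    exact ⟨l, hl.congr fun n => (integral_cond_ball_translate μ (v n) r x).symm⟩
  choose g hg using hlim
  have hgm : StronglyMeasurable g := stronglyMeasurable_of_tendsto atTop hwm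
    (tendsto_pi_nhds.2 hg)
  have hwg : Tendsto (fun n => ∫⁻ x, ENNReal.ofReal ‖w n x - g x‖ ∂ν) atTop (𝓝 0) :=
    tendsto_lintegral_norm_of_dominated_convergence (bound := fun _ => 1)
      (fun n => (hwm n).aestronglyMeasurable) (hasFiniteIntegral_const _)
      (fun n => Eventually.of_forall (hw1 n)) (Eventually.of_forall hg)
  refine ⟨g, hgm.aestronglyMeasurable, ?_⟩
  filter_upwards [hwg.eventually_lt_const (ENNReal.half_pos hδ), hη.eventually_lt_const hr]
    with n hn hηn
  calc ∫⁻ x, ‖v n x - g x‖ₑ ∂ν ≤ ∫⁻ x, (‖w n x - v n x‖ₑ + ‖w n x - g x‖ₑ) ∂ν := by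
        refine lintegral_mono fun x => ?_
        have : v n x - g x = (w n x - g x) - (w n x - v n x) := by ring
        rw [this, add_comm]
        exact enorm_sub_le
    _ = ∫⁻ x, ‖w n x - v n x‖ₑ ∂ν + ∫⁻ x, ‖w n x - g x‖ₑ ∂ν :=
        lintegral_add_left ((hwm n).measurable.sub (hv n)).enorm _
    _ ≤ δ / 2 + δ / 2 := by
        refine add_le_add ?_ ?_
        · calc ∫⁻ x, ‖w n x - v n x‖ₑ ∂ν ≤ ∫⁻ x, ‖w n x - v n x‖ₑ ∂μ :=
                lintegral_mono' hνμ le_rfl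
            _ ≤ ∫⁻ h, translationDefect μ (v n) h ∂π :=
                lintegral_enorm_integral_translate_sub_le (hv n) (hv1 n)
            _ ≤ ∫⁻ _, C * ENNReal.ofReal (r + r) ∂π := by
                refine lintegral_mono_ae ?_
                filter_upwards [ProbabilityTheory.ae_cond_mem
                  (μ := μ) Metric.isOpen_ball.measurableSet] with h hh
                refine (hC n h).trans ?_
                gcongr
                exact (mem_ball_zero_iff.1 hh).le
            _ = C * ENNReal.ofReal (r + r) := by simp
            _ ≤ δ / 2 := hrδ.le
        · simpa only [ofReal_norm] using hn.le
    _ = δ := ENNReal.add_halves δ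

/-- An `L¹` compactness criterion: a uniformly bounded sequence whose translation defects vanish
uniformly has an almost everywhere convergent subsequence. -/
theorem exists_subseq_ae_tendsto_of_translationDefect_le {μ : Measure E} [μ.IsAddHaarMeasure]
    {v : ℕ → E → ℝ} (hv : ∀ n, Measurable (v n)) (hv1 : ∀ n x, ‖v n x‖ ≤ 1) {η : ℕ → ℝ}
    (hη : Tendsto η atTop (𝓝 0)) {C : ℝ≥0}
    (hC : ∀ n h, translationDefect μ (v n) h ≤ C * ENNReal.ofReal (‖h‖ + η n)) :
    ∃ (s : ℕ → ℕ) (f : E → ℝ), StrictMono s ∧ Measurable f ∧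
      ∀ᵐ x ∂μ, Tendsto (fun k => v (s k) x) atTop (𝓝 (f x)) := by
  obtain ⟨ν, hν, hνμ, hμν⟩ := exists_isFiniteMeasure_le_absolutelyContinuous μ
  obtain ⟨s, hs, hconv⟩ := exists_subseq_forall_tendsto_integral_mul (μ := μ) hv hv1
  have hmem : ∀ n, MemLp (v (s n)) 1 ν := fun n =>
    MemLp.of_bound (hv _).aestronglyMeasurable 1 (Eventually.of_forall (hv1 _))
  have hcau : CauchySeq fun n => (hmem n).toLp :=
    cauchySeq_toLp_of_forall_eventually_lintegral_sub_le hmem fun δ hδ =>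
      eventually_lintegral_sub_le_of_translationDefect_le (η := η ∘ s) hνμ (fun n => hv (s n))
        (fun n => hv1 (s n)) (hη.comp hs.tendsto_atTop) (fun n => hC (s n)) hconv hδ
  obtain ⟨f, hf⟩ := cauchySeq_tendsto_of_complete hcau
  obtain ⟨t, ht, hft⟩ := (tendstoInMeasure_of_tendsto_Lp hf).exists_seq_tendsto_ae
  refine ⟨s ∘ t, f, hs.comp ht, (Lp.stronglyMeasurable f).measurable, hμν.ae_le ?_⟩
  filter_upwards [hft, ae_all_iff.2 fun n => (hmem n).coeFn_toLp] with x hx hx'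
  exact hx.congr fun k => hx' (t k)

theorem exists_subseq_ae_tendsto_indicator_of_translationDefect_le {μ : Measure E}
    [μ.IsAddHaarMeasure] {S : ℕ → Set E} (hS : ∀ n, MeasurableSet (S n)) {η : ℕ → ℝ}
    (hη : Tendsto η atTop (𝓝 0)) {C : ℝ≥0}
    (hC : ∀ n h, translationDefect μ ((S n).indicator fun _ => 1) h ≤
      C * ENNReal.ofReal (‖h‖ + η n)) :
    ∃ (s : ℕ → ℕ) (A : Set E), StrictMono s ∧ MeasurableSet A ∧
      ∀ᵐ x ∂μ, Tendsto (fun k => (S (s k)).indicator (fun _ => (1 : ℝ)) x) atTop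
        (𝓝 (A.indicator (fun _ => 1) x)) := by
  obtain ⟨s, f, hs, hf, hlim⟩ := exists_subseq_ae_tendsto_of_translationDefect_le
    (fun n => measurable_const.indicator (hS n))
    (fun n x => (norm_indicator_le_norm_self _ _).trans (by simp)) hη hC
  refine ⟨s, f ⁻¹' {1}, hs, hf (measurableSet_singleton 1), ?_⟩
  filter_upwards [hlim] with x hx
  -- Pointwise limits of indicators stay in the closed set `{0, 1}`, so `f` is almost everywhere the
  -- indicator of its level set at `1`.
  have hmem : f x ∈ ({0, 1} : Set ℝ) :=
    (Set.toFinite _).isClosed.mem_of_tendsto hx (Eventually.of_forall fun k => by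
      by_cases h : x ∈ S (s k) <;> simp [h])
  have : (f ⁻¹' {1}).indicator (fun _ => (1 : ℝ)) x = f x := by
    rcases hmem with h | h
    · simp [h]
    · rw [mem_singleton_iff] at h
      simp [h]
  rwa [this]

end Compactness

/-! ### From translation estimates to finite perimeter. -/

section Perimeter

theorem translationDefect_le_of_ae_tendsto {E : Type*} [NormedAddCommGroup E] [MeasurableSpace E]
    [BorelSpace E] {μ : Measure E} [μ.IsAddRightInvariant] {v : ℕ → E → ℝ} {f : E → ℝ}
    (hv : ∀ n, Measurable (v n)) (hlim : ∀ᵐ x ∂μ, Tendsto (fun n => v n x) atTop (𝓝 (f x)))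
    {h : E} {c : ℕ → ℝ≥0∞} {M : ℝ≥0∞} (hc : ∀ n, translationDefect μ (v n) h ≤ c n)
    (hcM : Tendsto c atTop (𝓝 M)) : translationDefect μ f h ≤ M := by
  calc translationDefect μ f h = ∫⁻ x, liminf (fun n => ‖v n (x + h) - v n x‖ₑ) atTop ∂μ := by
        refine lintegral_congr_ae ?_
        -- Fatou's lemma needs convergence at `x + h` too; translation preserves null sets.
        filter_upwards [hlim, (measurePreserving_add_right μ h).quasiMeasurePreserving.ae hlim]
          with x hx hxh
        exact ((hxh.sub hx).enorm.liminf_eq).symm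
    _ ≤ liminf (fun n => translationDefect μ (v n) h) atTop :=
        lintegral_liminf_le fun n => by fun_prop
    _ ≤ liminf c atTop := liminf_le_liminf (Eventually.of_forall hc)
    _ = M := hcM.liminf_eq

section LineDeriv

variable {E : Type*} [NormedAddCommGroup E] [MeasurableSpace E] [BorelSpace E]

/-- Discrete integration by parts: a change of variables moves the translation from `f` onto the
indicator, and `f` is then bounded by `1`. -/
theorem integral_translate_sub_mul_indicator_le {μ : Measure E} [μ.IsAddRightInvariant]
    [IsFiniteMeasureOnCompacts μ] {A : Set E} (hA : MeasurableSet A) {f : E → ℝ}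
    (hf : Continuous f) (hfc : HasCompactSupport f) (hf1 : ∀ x, ‖f x‖ ≤ 1) (h : E)
    (hfin : translationDefect μ (A.indicator fun _ => 1) (-h) ≠ ∞) :
    ∫ x, (f (x + h) - f x) * A.indicator (fun _ => 1) x ∂μ ≤
      (translationDefect μ (A.indicator fun _ => 1) (-h)).toReal := by
  set v : E → ℝ := A.indicator fun _ => 1 with hv
  have hvm : Measurable v := measurable_const.indicator hA
  have hv1 : ∀ x, ‖v x‖ ≤ 1 := fun x => (norm_indicator_le_norm_self _ _).trans (by simp)
  have hfi : Integrable f μ := hf.integrable_of_hasCompactSupport hfc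
  have hvh : Measurable fun x => v (x + -h) := hvm.comp (measurable_add_const _)
  have hi1 : Integrable (fun x => f x * v (x + -h)) μ :=
    hfi.mul_bdd (c := 1) hvh.aestronglyMeasurable (Eventually.of_forall fun x => hv1 _)
  have hi2 : Integrable (fun x => f x * v x) μ :=
    hfi.mul_bdd (c := 1) hvm.aestronglyMeasurable (Eventually.of_forall fun x => hv1 _)
  have hi3 : Integrable (fun x => f (x + h) * v x) μ := by
    simpa using hi1.comp_add_right h
  have hd : Integrable (fun x => v (x + -h) - v x) μ :=
    ⟨(hvh.sub hvm).aestronglyMeasurable, hfin.lt_top⟩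
  calc ∫ x, (f (x + h) - f x) * v x ∂μ
      = ∫ x, f (x + h) * v x ∂μ - ∫ x, f x * v x ∂μ := by
        rw [← integral_sub hi3 hi2]
        simp only [sub_mul]
    _ = ∫ x, f x * v (x + -h) ∂μ - ∫ x, f x * v x ∂μ := by
        rw [← integral_add_right_eq_self (fun x => f x * v (x + -h)) h]
        simp
    _ = ∫ x, f x * (v (x + -h) - v x) ∂μ := by
        rw [← integral_sub hi1 hi2]
        simp only [mul_sub]
    _ ≤ ∫ x, ‖v (x + -h) - v x‖ ∂μ := by
        refine integral_mono (hd.bdd_mul (c := 1) hf.aestronglyMeasurable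
          (Eventually.of_forall hf1)) hd.norm fun x => (Real.le_norm_self _).trans ?_
        rw [norm_mul]
        exact mul_le_of_le_one_left (norm_nonneg _) (hf1 x)
    _ = _ := integral_norm_eq_lintegral_enorm hd.aestronglyMeasurable

variable [NormedSpace ℝ E] [FiniteDimensional ℝ E]

theorem setIntegral_lineDeriv_le {μ : Measure E} [μ.IsAddHaarMeasure] {A : Set E}
    (hA : MeasurableSet A) {C : ℝ≥0}
    (hC : ∀ h, translationDefect μ (A.indicator fun _ => 1) h ≤ C * ENNReal.ofReal ‖h‖)
    {f : E → ℝ} {K : ℝ≥0} (hf : LipschitzWith K f) (hfc : HasCompactSupport f)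
    (hf1 : ∀ x, ‖f x‖ ≤ 1) (e : E) :
    ∫ x in A, lineDeriv ℝ f x e ∂μ ≤ C * ‖e‖ := by
  obtain ⟨R, hR⟩ := hfc.isBounded.subset_closedBall 0
  have hzero : ∀ x, x ∉ Metric.closedBall (0 : E) R → f x = 0 := fun x hx =>
    image_eq_zero_of_notMem_tsupport fun h => hx (hR h)
  -- `A` may have infinite measure, so its indicator is cut off to be integrable. The margin `‖e‖`
  -- ensures that `f` and `f (· + t • e)` vanish off `B` for `0 < t ≤ 1`.
  set B := Metric.closedBall (0 : E) (R + ‖e‖) with hB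
  have hRB : Metric.closedBall (0 : E) R ⊆ B :=
    Metric.closedBall_subset_closedBall (by simp)
  have hBm : MeasurableSet B := Metric.isClosed_closedBall.measurableSet
  have hg : Integrable ((A ∩ B).indicator fun _ => (1 : ℝ)) μ :=
    (integrable_indicator_iff (hA.inter hBm)).2 (integrableOn_const
      ((measure_mono inter_subset_right).trans_lt measure_closedBall_lt_top).ne)
  have hlim := hf.integral_inv_smul_sub_mul_tendsto_integral_lineDeriv_mul hg e
  have hderiv : ∀ x, x ∉ B → lineDeriv ℝ f x e = 0 := fun x hx => by
    have h0 : f =ᶠ[𝓝 x] fun _ => 0 := by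
      filter_upwards [Metric.isClosed_closedBall.isOpen_compl.mem_nhds hx] with y hy
      exact hzero y fun h => hy (hRB h)
    rw [h0.lineDeriv_eq]
    simp [lineDeriv]
  have heq : ∫ x, lineDeriv ℝ f x e * (A ∩ B).indicator (fun _ => (1 : ℝ)) x ∂μ =
      ∫ x in A, lineDeriv ℝ f x e ∂μ := by
    rw [← integral_indicator hA]
    refine integral_congr_ae (Eventually.of_forall fun x => ?_)
    by_cases hxB : x ∈ B
    · by_cases hxA : x ∈ A <;> simp [hxA, hxB]
    · simp [indicator, hderiv x hxB]
  rw [heq] at hlim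
  refine le_of_tendsto hlim ?_
  filter_upwards [Ioc_mem_nhdsGT zero_lt_one] with t ht
  have hle : translationDefect μ (A.indicator fun _ => 1) (-(t • e)) ≤
      ENNReal.ofReal (C * (t * ‖e‖)) := by
    refine (hC _).trans_eq ?_
    rw [norm_neg, norm_smul, Real.norm_of_nonneg ht.1.le, ENNReal.ofReal_mul (p := (C : ℝ)) C.coe_nonneg,
      ENNReal.ofReal_coe_nnreal]
  calc ∫ x, (t⁻¹ • (f (x + t • e) - f x)) * (A ∩ B).indicator (fun _ => (1 : ℝ)) x ∂μ
      = t⁻¹ * ∫ x, (f (x + t • e) - f x) * A.indicator (fun _ => (1 : ℝ)) x ∂μ := by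
        rw [← integral_const_mul]
        refine integral_congr_ae (Eventually.of_forall fun x => ?_)
        by_cases hxB : x ∈ B
        · by_cases hxA : x ∈ A <;> simp [hxA, hxB]
        · have h1 : f x = 0 := hzero x fun h => hxB (hRB h)
          have h2 : f (x + t • e) = 0 := by
            refine hzero _ fun h => hxB ?_
            rw [hB, mem_closedBall_zero_iff]
            rw [mem_closedBall_zero_iff] at h
            have h3 : ‖x‖ ≤ ‖x + t • e‖ + ‖t • e‖ := by
              simpa using norm_sub_le (x + t • e) (t • e)
            have h4 : ‖t • e‖ ≤ ‖e‖ := by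
              rw [norm_smul, Real.norm_of_nonneg ht.1.le]
              exact mul_le_of_le_one_left (norm_nonneg _) ht.2
            linarith
          simp [h1, h2]
    _ ≤ t⁻¹ * (C * (t * ‖e‖)) := by
        have := ht.1
        gcongr
        refine (integral_translate_sub_mul_indicator_le hA hf.continuous hfc hf1 _
          (hle.trans_lt ENNReal.ofReal_lt_top).ne).trans ?_
        exact ENNReal.toReal_le_of_le_ofReal (by positivity) hle
    _ = C * ‖e‖ := by
        have := ht.1.ne'
        field_simp

end LineDeriv

theorem perimeter_le_of_translationDefect_le {d : ℕ} {A : Set (EuclideanSpace ℝ (Fin d))}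
    (hA : MeasurableSet A) {C : ℝ≥0}
    (hC : ∀ h, translationDefect volume (A.indicator fun _ => 1) h ≤ C * ENNReal.ofReal ‖h‖) :
    perimeter A ≤ ENNReal.ofReal (d * C) := by
  refine iSup_le fun φ => iSup_le fun hφ => iSup_le fun hφc => iSup_le fun hφ1 =>
    ENNReal.ofReal_le_ofReal ?_
  have hcoord : ∀ k : Fin d, ContDiff ℝ 1 fun x => φ x k := fun k =>
    (EuclideanSpace.proj k : EuclideanSpace ℝ (Fin d) →L[ℝ] ℝ).contDiff.comp hφ
  have hcoordc : ∀ k : Fin d, HasCompactSupport fun x => φ x k := fun k =>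
    hφc.comp_left (g := fun y : EuclideanSpace ℝ (Fin d) => y k) rfl
  have hderiv : ∀ (k : Fin d) x, (fderiv ℝ φ x (EuclideanSpace.single k 1)) k =
      lineDeriv ℝ (fun x => φ x k) x (EuclideanSpace.single k 1) := fun k x => by
    have hd : HasFDerivAt φ (fderiv ℝ φ x) x :=
      (hφ.differentiable one_ne_zero x).hasFDerivAt
    have := (EuclideanSpace.proj k : EuclideanSpace ℝ (Fin d) →L[ℝ] ℝ).hasFDerivAt.comp x hd
    exact (this.hasLineDerivAt (EuclideanSpace.single k 1)).lineDeriv.symm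
  have hcont : ∀ k : Fin d, Continuous fun x =>
      (fderiv ℝ φ x (EuclideanSpace.single k 1)) k := fun k =>
    (EuclideanSpace.proj k : EuclideanSpace ℝ (Fin d) →L[ℝ] ℝ).continuous.comp
      ((hφ.continuous_fderiv one_ne_zero).clm_apply continuous_const)
  have hint : ∀ k : Fin d, Integrable fun x =>
      (fderiv ℝ φ x (EuclideanSpace.single k 1)) k := fun k =>
    (hcont k).integrable_of_hasCompactSupport
      ((hφc.fderiv ℝ).comp_left (g := fun T : EuclideanSpace ℝ (Fin d) →L[ℝ]
        EuclideanSpace ℝ (Fin d) => T (EuclideanSpace.single k 1) k) rfl)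
  unfold divergence
  rw [integral_finsetSum _ fun k _ => (hint k).integrableOn]
  calc ∑ k : Fin d, ∫ x in A, (fderiv ℝ φ x (EuclideanSpace.single k 1)) k
      ≤ ∑ _k : Fin d, (C : ℝ) := by
        refine Finset.sum_le_sum fun k _ => ?_
        simp_rw [hderiv k]
        obtain ⟨K, hK⟩ := (hcoord k).lipschitzWith_of_hasCompactSupport (hcoordc k) one_ne_zero
        simpa using setIntegral_lineDeriv_le hA hC hK (hcoordc k)
          (fun x => (PiLp.norm_apply_le (φ x) k).trans (hφ1 x)) (EuclideanSpace.single k 1)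
    _ = d * C := by simp

theorem tendstoL1Loc_of_ae_tendsto {d : ℕ} {v : ℕ → EuclideanSpace ℝ (Fin d) → ℝ}
    {f : EuclideanSpace ℝ (Fin d) → ℝ} (hv : ∀ n, AEStronglyMeasurable (v n) volume)
    (hv1 : ∀ n, ∀ᵐ x, ‖v n x‖ ≤ 1) (hlim : ∀ᵐ x, Tendsto (fun n => v n x) atTop (𝓝 (f x))) :
    TendstoL1Loc v f := by
  have hfm : AEStronglyMeasurable f volume := aestronglyMeasurable_of_tendsto_ae atTop hv hlim
  have hf1 : ∀ᵐ x, ‖f x‖ ≤ 1 := by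
    filter_upwards [ae_all_iff.2 hv1, hlim] with x hx hl
    exact le_of_tendsto hl.norm (Eventually.of_forall hx)
  have hloc : ∀ {w : EuclideanSpace ℝ (Fin d) → ℝ}, AEStronglyMeasurable w volume →
      (∀ᵐ x, ‖w x‖ ≤ 1) → LocallyIntegrable w volume := fun hw hw1 =>
    (memLp_top_of_bound hw 1 hw1).locallyIntegrable le_top
  refine ⟨fun n => hloc (hv n) (hv1 n), hloc hfm hf1, fun K hK => ?_⟩
  have : IsFiniteMeasure (volume.restrict K) := ⟨by simpa using hK.measure_lt_top⟩
  have := tendsto_lintegral_norm_of_dominated_convergence (μ := volume.restrict K)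
    (bound := fun _ => 1)
    (fun n => (hv n).restrict) (hasFiniteIntegral_const _)
    (fun n => ae_restrict_of_ae (hv1 n)) (ae_restrict_of_ae hlim)
  simpa only [eLpNorm_one_eq_lintegral_enorm, ofReal_norm, Pi.sub_apply] using this

end Perimeter

/-! ### Voronoi cells and the energy estimate. -/

section Voronoi

variable {d : ℕ} {L : Set (EuclideanSpace ℝ (Fin d))}

theorem IsDiscretePeriodic.countable (hL : IsDiscretePeriodic L) : L.Countable := by
  refine (countable_iUnion fun n : ℕ => (hL.finite_inter_ball n).countable).mono fun x hx => ?_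
  obtain ⟨n, hn⟩ := exists_nat_ge ‖x‖
  exact mem_iUnion.2 ⟨n, hx, mem_closedBall_zero_iff.2 hn⟩

/-- The translations preserving `L` form a group, hence contain the integer span of the basis.
Rounding `x - i₀` down to that span moves it by at most `∑ k, ‖b k‖`. -/
theorem IsDiscretePeriodic.exists_forall_exists_dist_lt (hL : IsDiscretePeriodic L) :
    ∃ D : ℝ, 0 < D ∧ ∀ x, ∃ i ∈ L, dist x i < D := by
  obtain ⟨b, hb⟩ := hL.periodic
  obtain ⟨i₀, hi₀⟩ := hL.nonempty
  have hspan : Submodule.span ℤ (range b) ≤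
      (AddAction.stabilizer (EuclideanSpace ℝ (Fin d)) L).toIntSubmodule := by
    refine Submodule.span_le.2 ?_
    rintro _ ⟨k, rfl⟩
    change b k +ᵥ L = L
    rw [← image_vadd]
    simpa only [vadd_eq_add, add_comm] using hb k
  refine ⟨∑ k, ‖b k‖ + 1, by positivity, fun x => ?_⟩
  refine ⟨(ZSpan.floor b (x - i₀) : EuclideanSpace ℝ (Fin d)) + i₀, ?_, ?_⟩
  · have h : (ZSpan.floor b (x - i₀) : EuclideanSpace ℝ (Fin d)) +ᵥ L = L :=
      hspan (ZSpan.floor b (x - i₀)).2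
    exact h.subset (vadd_mem_vadd_set hi₀)
  · have h := ZSpan.norm_fract_le b (x - i₀)
    rw [ZSpan.fract_apply] at h
    rw [dist_eq_norm, add_comm, ← sub_sub]
    linarith

theorem measurableSet_voronoiCell (hL : L.Countable) (i : EuclideanSpace ℝ (Fin d)) :
    MeasurableSet (voronoiCell L i) := by
  have : voronoiCell L i = ⋂ j ∈ L, {x | j ≠ i → dist x i < dist x j} := by
    ext x
    simp [voronoiCell]
  rw [this]
  refine MeasurableSet.biInter hL fun j _ => ?_
  by_cases h : j = i
  · simp [h]
  · simpa [h] using measurableSet_lt (by fun_prop : Measurable fun x => dist x i) (by fun_prop)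

theorem voronoiCell_subset_ball {D : ℝ} (hD : ∀ x, ∃ i ∈ L, dist x i < D)
    (i : EuclideanSpace ℝ (Fin d)) : voronoiCell L i ⊆ Metric.ball i D := by
  intro x hx
  obtain ⟨j, hj, hxj⟩ := hD x
  by_cases h : j = i
  · exact h ▸ hxj
  · exact (hx j hj h).trans hxj

theorem IsDiscretePeriodic.exists_forall_dist_le (hL : IsDiscretePeriodic L)
    (x : EuclideanSpace ℝ (Fin d)) : ∃ i ∈ L, ∀ j ∈ L, dist x i ≤ dist x j := by
  obtain ⟨i₀, hi₀⟩ := hL.nonempty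
  have hmem : ∀ j ∈ L, dist x j ≤ dist x i₀ →
      j ∈ L ∩ Metric.closedBall 0 (‖x‖ + dist x i₀) := fun j hj h => by
    refine ⟨hj, mem_closedBall_zero_iff.2 ?_⟩
    have : ‖j‖ ≤ ‖x‖ + dist x j := by
      rw [dist_eq_norm]
      simpa using norm_sub_le x (x - j)
    linarith
  obtain ⟨i, hi, hmin⟩ := (hL.finite_inter_ball (‖x‖ + dist x i₀)).exists_minimalFor
    (fun j => dist x j) _ ⟨i₀, hmem i₀ hi₀ le_rfl⟩
  refine ⟨i, hi.1, fun j hj => ?_⟩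
  rcases le_total (dist x j) (dist x i₀) with h | h
  · rcases le_total (dist x i) (dist x j) with h' | h'
    · exact h'
    · exact hmin (hmem j hj h) h'
  · refine le_trans ?_ h
    rcases le_total (dist x i) (dist x i₀) with h' | h'
    · exact h'
    · exact hmin (hmem i₀ hi₀ le_rfl) h'

/-- A nearest point always exists; it fails to be unique only on countably many perpendicular
bisectors, which are null. -/
theorem IsDiscretePeriodic.ae_exists_mem_voronoiCell (hL : IsDiscretePeriodic L) :
    ∀ᵐ x, ∃ i ∈ L, x ∈ voronoiCell L i := by
  have hne : ∀ᵐ x, ∀ i ∈ L, ∀ j ∈ L, j ≠ i → dist x i ≠ dist x j := by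
    refine (ae_ball_iff hL.countable).2 fun i _ => (ae_ball_iff hL.countable).2 fun j _ => ?_
    by_cases hij : j = i
    · simp [hij]
    · have h := Measure.addHaar_affineSubspace (volume : Measure (EuclideanSpace ℝ (Fin d)))
        (AffineSubspace.perpBisector i j) (by simpa using Ne.symm hij)
      filter_upwards [measure_eq_zero_iff_ae_notMem.1 h] with x hx _ hdist
      exact hx (AffineSubspace.mem_perpBisector_iff_dist_eq.2 hdist)
  filter_upwards [hne] with x hx
  obtain ⟨i, hi, hmin⟩ := hL.exists_forall_dist_le x
  exact ⟨i, hi, fun j hj hji => lt_of_le_of_ne (hmin j hj) (hx i hi j hj hji)⟩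

theorem IsDiscretePeriodic.ae_exists_mem_smul_voronoiCell (hL : IsDiscretePeriodic L) {ε : ℝ}
    (hε : 0 < ε) : ∀ᵐ x, ∃ i : L, x ∈ ε • voronoiCell L i := by
  have h : volume (ε • {x | ¬ ∃ i ∈ L, x ∈ voronoiCell L i}) = 0 := by
    rw [Measure.addHaar_smul, ae_iff.1 hL.ae_exists_mem_voronoiCell, mul_zero]
  filter_upwards [measure_eq_zero_iff_ae_notMem.1 h] with x hx
  rw [mem_smul_set_iff_inv_smul_mem₀ hε.ne', mem_ofPred_eq, not_not] at hx
  obtain ⟨i, hi, hxi⟩ := hx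
  exact ⟨⟨i, hi⟩, (mem_smul_set_iff_inv_smul_mem₀ hε.ne' _ _).2 hxi⟩

theorem mem_ball_of_mem_smul_voronoiCell {D ε : ℝ} (hD : ∀ x, ∃ i ∈ L, dist x i < D)
    (hε : 0 < ε) {i x : EuclideanSpace ℝ (Fin d)} (hx : x ∈ ε • voronoiCell L i) :
    x ∈ Metric.ball (ε • i) (ε * D) := by
  obtain ⟨y, hy, rfl⟩ := hx
  have := voronoiCell_subset_ball hD i hy
  rw [Metric.mem_ball] at this ⊢
  rw [dist_smul₀, Real.norm_of_nonneg hε.le]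
  gcongr

/-- The region where the interpolation of a spin function equals `1`. -/
def SpinFunction.phase {ε : ℝ} (u : SpinFunction L ε) : Set (EuclideanSpace ℝ (Fin d)) :=
  ⋃ i : {i : L // u.site i = 1}, ε • voronoiCell L i.1

theorem SpinFunction.measurableSet_phase {ε : ℝ} (hε : 0 < ε) (hL : L.Countable)
    (u : SpinFunction L ε) : MeasurableSet u.phase := by
  have := hL.to_subtype
  exact MeasurableSet.iUnion fun i =>
    (measurableSet_voronoiCell hL _).const_smul_of_ne_zero hε.ne'

theorem SpinFunction.interpolation_eq_indicator {ε : ℝ} (hε : 0 < ε) (u : SpinFunction L ε) :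
    u.interpolation = u.phase.indicator fun _ => 1 := by
  ext x
  by_cases hx : x ∈ u.phase
  · obtain ⟨i, hi⟩ := mem_iUnion.1 hx
    rw [u.interpolation_eq hε i.1 hi, i.2, indicator_of_mem hx]
  · rw [indicator_of_notMem hx]
    by_cases h : ∃ i : L, x ∈ ε • voronoiCell L i
    · obtain ⟨i, hi⟩ := h
      rw [u.interpolation_eq hε i hi]
      have h01 : u.site i ∈ ({0, 1} : Set ℝ) := Subtype.mem _
      exact h01.resolve_right fun h1 => hx (mem_iUnion.2 ⟨⟨i, h1⟩, hi⟩)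
    · rw [SpinFunction.interpolation, dif_neg h]

theorem sub_mem_cube {ε η D : ℝ} (hε : 0 < ε) (h : 8 * (ε * D) ≤ η)
    {i j x y : EuclideanSpace ℝ (Fin d)} (hx : x ∈ Metric.ball (ε • i) (ε * D))
    (hy : y ∈ Metric.ball (ε • j) (ε * D)) (hxy : y ∈ Metric.ball x (η / 4)) :
    i - j ∈ cube (η / ε) := by
  intro k
  -- The two radii `ε * D` contribute at most `η / 4` together, the distance from `x` to `y` less
  -- than `η / 4`.
  have hdist : dist (ε • i) (ε • j) < η / 2 := by
    rw [Metric.mem_ball] at hx hy hxy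
    have h1 := dist_triangle4 (ε • i) x y (ε • j)
    rw [dist_comm (ε • i) x, dist_comm x y] at h1
    linarith
  rw [dist_smul₀, Real.norm_of_nonneg hε.le, dist_eq_norm, mul_comm, ← lt_div_iff₀ hε] at hdist
  have hk := (PiLp.norm_apply_le (i - j) k).trans_lt hdist
  rw [Real.norm_eq_abs, abs_lt, div_right_comm] at hk
  exact ⟨hk.1.le, hk.2⟩

/-- For almost all `(x, y)` the integrand is zero or equals the term of the pair of cells containing
`x` and `y`. Enlarging cells to balls only overcounts, and gives every pair the same weight. -/
theorem SpinFunction.lintegral_interpolation_le (hL : IsDiscretePeriodic L) {D : ℝ}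
    (hD : ∀ x, ∃ i ∈ L, dist x i < D) {ε η : ℝ} (hε : 0 < ε) (h : 8 * (ε * D) ≤ η)
    (u : SpinFunction L ε) :
    ∫⁻ x, ∫⁻ y, (Metric.ball x (η / 4)).indicator
        (fun y => ‖u.interpolation y - u.interpolation x‖ₑ) y ≤
      volume (Metric.ball (0 : EuclideanSpace ℝ (Fin d)) (ε * D)) ^ 2 *
        ∑' p : {p : L × L // (p.1 : EuclideanSpace ℝ (Fin d)) -
          (p.2 : EuclideanSpace ℝ (Fin d)) ∈ cube (η / ε)},
          ENNReal.ofReal |u.site p.1.1 - u.site p.1.2| := by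
  have := hL.countable.to_subtype
  set P := {p : L × L // (p.1 : EuclideanSpace ℝ (Fin d)) -
    (p.2 : EuclideanSpace ℝ (Fin d)) ∈ cube (η / ε)}
  let B : L → Set (EuclideanSpace ℝ (Fin d)) := fun i => Metric.ball (ε • i.1) (ε * D)
  have hBm : ∀ i, MeasurableSet (B i) := fun i => Metric.isOpen_ball.measurableSet
  have hBv : ∀ i, volume (B i) = volume (Metric.ball (0 : EuclideanSpace ℝ (Fin d)) (ε * D)) :=
    fun i => Measure.addHaar_ball_center _ _ _
  have hcell := hL.ae_exists_mem_smul_voronoiCell hε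
  have hm : ∀ i, Measurable ((B i).indicator fun _ => (1 : ℝ≥0∞)) := fun i =>
    measurable_const.indicator (hBm i)
  have hi : ∀ i, ∫⁻ x, (B i).indicator (fun _ => (1 : ℝ≥0∞)) x =
      volume (Metric.ball (0 : EuclideanSpace ℝ (Fin d)) (ε * D)) := fun i => by
    rw [lintegral_indicator (hBm i), setLIntegral_const, one_mul, hBv]
  calc _ ≤ ∫⁻ x, ∫⁻ y, ∑' p : P, ENNReal.ofReal |u.site p.1.1 - u.site p.1.2| *
          (B p.1.1).indicator (fun _ => 1) x * (B p.1.2).indicator (fun _ => 1) y := by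
        refine lintegral_mono_ae ?_
        filter_upwards [hcell] with x ⟨i, hxi⟩
        refine lintegral_mono_ae ?_
        filter_upwards [hcell] with y ⟨j, hyj⟩
        by_cases hxy : y ∉ Metric.ball x (η / 4)
        · simp [indicator_of_notMem hxy]
        rw [not_not] at hxy
        rw [indicator_of_mem hxy]
        have hxB := mem_ball_of_mem_smul_voronoiCell hD hε hxi
        have hyB := mem_ball_of_mem_smul_voronoiCell hD hε hyj
        refine le_trans ?_ (ENNReal.le_tsum ⟨(i, j), sub_mem_cube hε h hxB hyB hxy⟩)
        have h1 : (B i).indicator (fun _ => (1 : ℝ≥0∞)) x = 1 := indicator_of_mem hxB _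
        have h2 : (B j).indicator (fun _ => (1 : ℝ≥0∞)) y = 1 := indicator_of_mem hyB _
        simp only [h1, h2, mul_one]
        rw [u.interpolation_eq hε i hxi, u.interpolation_eq hε j hyj, enorm_sub_rev,
          Real.enorm_eq_ofReal_abs]
    _ = ∑' p : P, ENNReal.ofReal |u.site p.1.1 - u.site p.1.2| *
          volume (Metric.ball (0 : EuclideanSpace ℝ (Fin d)) (ε * D)) *
          volume (Metric.ball (0 : EuclideanSpace ℝ (Fin d)) (ε * D)) := by
        simp_rw [lintegral_tsum fun p : P => ((hm p.1.2).const_mul _).aemeasurable,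
          lintegral_const_mul _ (hm _), hi]
        rw [lintegral_tsum fun p : P => (((hm p.1.1).const_mul _).mul_const _).aemeasurable]
        simp_rw [lintegral_mul_const _ ((hm _).const_mul _), lintegral_const_mul _ (hm _), hi]
    _ = _ := by
        simp_rw [mul_assoc]
        rw [ENNReal.tsum_mul_right, mul_comm, sq]

theorem SpinFunction.translationDefect_interpolation_le (hL : IsDiscretePeriodic L) {D : ℝ}
    (hD0 : 0 < D) (hD : ∀ x, ∃ i ∈ L, dist x i < D) {ε η : ℝ} (hε : 0 < ε)
    (h : 8 * (ε * D) ≤ η) (u : SpinFunction L ε) (v : EuclideanSpace ℝ (Fin d)) :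
    translationDefect volume u.interpolation v ≤
      volume (Metric.ball (0 : EuclideanSpace ℝ (Fin d)) 1) *
        ENNReal.ofReal (16 * 8 ^ d * D ^ (2 * d)) * energy ε η u *
        ENNReal.ofReal (‖v‖ + η) := by
  have hη : 0 < η := lt_of_lt_of_le (by positivity) h
  have hm : Measurable u.interpolation := by
    rw [u.interpolation_eq_indicator hε]
    exact measurable_const.indicator (u.measurableSet_phase hε hL.countable)
  set β := volume (Metric.ball (0 : EuclideanSpace ℝ (Fin d)) 1) with hβ
  have hβ0 : β ≠ 0 := (Metric.measure_ball_pos _ _ one_pos).ne'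
  have hβt : β ≠ ∞ := measure_ball_lt_top.ne
  have hball : ∀ r : ℝ, 0 < r →
      volume (Metric.ball (0 : EuclideanSpace ℝ (Fin d)) r) = ENNReal.ofReal (r ^ d) * β :=
    fun r hr => by
      rw [Measure.addHaar_ball_of_pos _ _ hr, finrank_euclideanSpace_fin]
  have hsmall : ∀ k : EuclideanSpace ℝ (Fin d), ‖k‖ < η / 8 →
      translationDefect volume u.interpolation k ≤
        β * ENNReal.ofReal (2 * 8 ^ d * D ^ (2 * d) * η) * energy ε η u := by
    intro k hk
    have h1 := measure_ball_mul_translationDefect_le (μ := volume) hm hk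
    -- The radius `η / 8` is chosen so that its double is the range `η / 4` of the energy estimate.
    rw [show 2 * (η / 8) = η / 4 by ring, setLIntegral_ball_translationDefect hm] at h1
    have h2 := h1.trans (mul_le_mul_right (u.lintegral_interpolation_le hL hD hε h) 2)
    rw [hball _ (by positivity), hball _ (by positivity)] at h2
    unfold energy
    set σ := ∑' p : {p : L × L // (p.1 : EuclideanSpace ℝ (Fin d)) -
          (p.2 : EuclideanSpace ℝ (Fin d)) ∈ cube (η / ε)},
          ENNReal.ofReal |u.site p.1.1 - u.site p.1.2|
    have hc0 : ENNReal.ofReal ((η / 8) ^ d) * β ≠ 0 :=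
      mul_ne_zero (ENNReal.ofReal_pos.2 (by positivity)).ne' hβ0
    have hct : ENNReal.ofReal ((η / 8) ^ d) * β ≠ ∞ := ENNReal.mul_ne_top ENNReal.ofReal_ne_top hβt
    refine (ENNReal.mul_le_mul_iff_right hc0 hct).1 (h2.trans_eq ?_)
    have e : (2 : ℝ≥0∞) = ENNReal.ofReal 2 := by simp
    -- Scaling: dividing `ε ^ (2 * d)` by the ball volume of order `η ^ d` leaves the energy
    -- prefactor times `η`.
    have e1 : ENNReal.ofReal 2 * ENNReal.ofReal ((ε * D) ^ d) ^ 2 =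
        ENNReal.ofReal ((η / 8) ^ d) * ENNReal.ofReal (2 * 8 ^ d * D ^ (2 * d) * η) *
          ENNReal.ofReal (ε ^ (2 * d) / η ^ (d + 1)) := by
      rw [← ENNReal.ofReal_pow (by positivity), ← ENNReal.ofReal_mul (by positivity),
        ← ENNReal.ofReal_mul (by positivity), ← ENNReal.ofReal_mul (by positivity)]
      congr 1
      rw [div_pow, mul_pow, mul_pow]
      field_simp
      ring
    calc 2 * ((ENNReal.ofReal ((ε * D) ^ d) * β) ^ 2 * σ)
        = ENNReal.ofReal 2 * ENNReal.ofReal ((ε * D) ^ d) ^ 2 * β ^ 2 * σ := by rw [e]; ring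
      _ = _ := by rw [e1]; ring
  refine (translationDefect_le_of_forall_norm_lt hm (by positivity) hsmall v).trans ?_
  have e2 : ENNReal.ofReal (‖v‖ / (η / 8) + 1) * ENNReal.ofReal (2 * 8 ^ d * D ^ (2 * d) * η) ≤
      ENNReal.ofReal (16 * 8 ^ d * D ^ (2 * d)) * ENNReal.ofReal (‖v‖ + η) := by
    rw [← ENNReal.ofReal_mul (by positivity), ← ENNReal.ofReal_mul (by positivity)]
    refine ENNReal.ofReal_le_ofReal ?_
    have e3 : (‖v‖ / (η / 8) + 1) * (2 * 8 ^ d * D ^ (2 * d) * η) =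
        2 * 8 ^ d * D ^ (2 * d) * (8 * ‖v‖ + η) := by field_simp
    have e4 : 16 * 8 ^ d * D ^ (2 * d) * (‖v‖ + η) =
        2 * 8 ^ d * D ^ (2 * d) * (8 * ‖v‖ + 8 * η) := by ring
    rw [e3, e4]
    gcongr
    linarith
  calc _ = ENNReal.ofReal (‖v‖ / (η / 8) + 1) *
          ENNReal.ofReal (2 * 8 ^ d * D ^ (2 * d) * η) * β * energy ε η u := by ring
    _ ≤ ENNReal.ofReal (16 * 8 ^ d * D ^ (2 * d)) * ENNReal.ofReal (‖v‖ + η) * β *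
          energy ε η u := by gcongr
    _ = _ := by ring

end Voronoi

/-! ### The compactness theorem. -/

theorem mainTheorem2 (d : ℕ) (hd : 1 ≤ d) (L : Set (EuclideanSpace ℝ (Fin d)))
    (hL : IsDiscretePeriodic L) (ε η : ℕ → ℝ) (hε : ∀ n, 0 < ε n) (hη : ∀ n, 0 < η n)
    (hε0 : Tendsto ε atTop (𝓝 0)) (hη0 : Tendsto η atTop (𝓝 0))
    (hεη : Tendsto (fun n => ε n / η n) atTop (𝓝 0))
    (u : ∀ n, SpinFunction L (ε n))
    (hu : ∃ C : ℝ≥0, ∀ n, energy (ε n) (η n) (u n) ≤ C) :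
    ∃ (s : ℕ → ℕ) (A : Set (EuclideanSpace ℝ (Fin d))), StrictMono s ∧ HasFinitePerimeter A ∧
      TendstoL1Loc (fun k => (u (s k)).interpolation) (A.indicator (fun _ => 1)) := by
  obtain ⟨C, hC⟩ := hu
  obtain ⟨D, hD0, hD⟩ := hL.exists_forall_exists_dist_lt
  -- The scale separation `8 * (ε * D) ≤ η` holds only for large indices, so the first `N` terms are
  -- dropped.
  obtain ⟨N, hN⟩ := eventually_atTop.1
    (hεη.eventually_lt_const (by positivity : (0 : ℝ) < 1 / (8 * D)))
  have hsmall : ∀ n, 8 * (ε (n + N) * D) ≤ η (n + N) := fun n => by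
    have := hN (n + N) (Nat.le_add_left _ _)
    rw [div_lt_div_iff₀ (hη _) (by positivity)] at this
    linarith
  have hS : ∀ n, MeasurableSet (u n).phase := fun n =>
    (u n).measurableSet_phase (hε n) hL.countable
  set M : ℝ≥0∞ := volume (Metric.ball (0 : EuclideanSpace ℝ (Fin d)) 1) *
    ENNReal.ofReal (16 * 8 ^ d * D ^ (2 * d)) * C with hM
  have hMt : M ≠ ∞ := ENNReal.mul_ne_top (ENNReal.mul_ne_top measure_ball_lt_top.ne
    ENNReal.ofReal_ne_top) ENNReal.coe_ne_top
  have hdefect : ∀ n h, translationDefect volume ((u (n + N)).phase.indicator fun _ => 1) h ≤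
      M.toNNReal * ENNReal.ofReal (‖h‖ + η (n + N)) := fun n h => by
    rw [← (u (n + N)).interpolation_eq_indicator (hε _), ENNReal.coe_toNNReal hMt]
    refine ((u (n + N)).translationDefect_interpolation_le hL hD0 hD (hε _) (hsmall n) h).trans ?_
    rw [hM]
    gcongr
    exact hC _
  have hηN : Tendsto (fun n => η (n + N)) atTop (𝓝 0) := (tendsto_add_atTop_iff_nat N).2 hη0
  obtain ⟨s, A, hs, hA, hlim⟩ := exists_subseq_ae_tendsto_indicator_of_translationDefect_le
    (fun n => hS (n + N)) hηN hdefect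
  -- The error `η` disappears in the limit, leaving a bound linear in `‖h‖`.
  have hAdefect : ∀ h, translationDefect volume (A.indicator fun _ => 1) h ≤
      M.toNNReal * ENNReal.ofReal ‖h‖ := fun h => by
    refine translationDefect_le_of_ae_tendsto
      (fun n => measurable_const.indicator (hS (s n + N))) hlim (fun n => hdefect (s n) h) ?_
    refine ENNReal.Tendsto.const_mul ?_ (Or.inr ENNReal.coe_ne_top)
    refine ENNReal.tendsto_ofReal ?_
    simpa using (hηN.comp hs.tendsto_atTop).const_add ‖h‖
  refine ⟨fun k => s k + N, A, fun a b hab => Nat.add_lt_add_right (hs hab) N,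
    ⟨hA, (perimeter_le_of_translationDefect_le hA hAdefect).trans_lt ENNReal.ofReal_lt_top⟩, ?_⟩
  simp_rw [fun k => (u (s k + N)).interpolation_eq_indicator (hε _)]
  exact tendstoL1Loc_of_ae_tendsto
    (fun n => (measurable_const.indicator (hS _)).aestronglyMeasurable)
    (fun n => Eventually.of_forall fun x => (norm_indicator_le_norm_self _ _).trans (by simp)) hlim
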